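/- **Definitions.** Let $p$ be a prime and $n\ge 0$. A pseudobrace of cardinality $p^n$ is an abelian group $(A,+)$ of cardinality $p^n$ with a binary operation $\circ$ such that, writing $a*b=a\circ b-a-b$, the following hold for all $a,b,c\in A$. (i) There is an element $a^{\circ -1}$ with $a\circ a^{\circ -1}=0$. Put $a^{\circ 0}=0$, $a^{\circ 1}=a$, $a^{\circ (i+1)}=a\circ a^{\circ i}$ for $i\ge 1$, and $a^{\circ -(i+1)}=a^{\circ -1}\circ a^{\circ -i}$ for $i\ge 1$. (ii) $(a^{\circ i}\circ a^{\circ j})\circ b=a^{\circ (i+j)}\circ b$ and $a^{\circ i}\circ a^{\circ j}=a^{\circ (i+j)}$ for all integers $i,j$, and $a^{\circ i}\circ b=a\circ(a\circ(\cdots (a\circ b)))$ with $i$ occurrences of $a$ on the right, for all $i\ge 0$. (iii) $A^{n+1}=0$, where $A^1=A$ and $A^{i+1}$ is the additive subgroup generated by all $x*y$ with $x\in A$, $y\in A^i$. (iv) $a*(b+c)=a*b+a*c$. Put $p^iA=\{p^ia: a\in A\}$ and $\mathrm{ann}(p^i)=\{a\in A: p^ia=0\}$. An additive subgroup $I$ of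 $A$ is an ideal if $a*i\in I$, $i*a\in I$ and $(a+i)*(b+j)-a*b\in I$ for all $a,b\in A$ and $i,j\in I$; then $[a]*[b]=[a*b]$ is well defined on $A/I$. Let $p>3$ and $m=\lfloor\frac{p-1}{4}\rfloor$. $A$ satisfies *Property 1* if, with $a$ occurring $m$ times in each expression, $a*(a*(\cdots (a*b)))\in pA$ for all $a,b\in A$, and $a*(a*(\cdots (a*b)))\in \mathrm{ann}(p^{i-1})$ for all $a\in A$, $i>0$ and $b\in\mathrm{ann}(p^i)$. $A$ satisfies *Property 2* for the natural number $k$ if, for all $a,b\in A$, $p^{2k}a=p^{2k}b$ if and only if $p^ka^{\circ p^k}=p^kb^{\circ p^k}$, and moreover all $p^iA$ and $\mathrm{ann}(p^i)$ are ideals and $(p^iA)*\mathrm{ann}(p^j)\subseteq \mathrm{ann}(p^{j-i})$ for all $j\ge i$. If Property 2 holds for $k$, write $[a]$ for the class of $a$ in $A/\mathrm{ann}(p^{2k})$, and define $[x]\odot[y]=[z]$, where $z\in A$ is any element with $p^kz=(p^kx)*y$; this operation on $A/\mathrm{ann}(p^{2k})$ is well defined. **Theorem.** Let $p>3$ be a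 prime and let $n,k$ be natural numbers. There is a formal expression $t(x,y)$ in two variables, built from the binary symbols $+$, $\odot$ and the unary symbol $\rho^{-1}$ and depending only on $p,n,k$, such that the following holds for every pseudobrace $A$ of cardinality $p^n$ that satisfies Property 1 and Property 2 for $k$, every function $\rho^{-1}:pA\to A$ with $p\,\rho^{-1}(x)=x$ for all $x\in pA$, and all $a,b\in A$. Evaluate $t$ at $x=[a]$, $y=[b]$ in $A/\mathrm{ann}(p^{2k})$, where a step $\rho^{-1}$ takes a class $[z]$ with $z\in pA$ to $[\rho^{-1}(z)]$, for an arbitrarily chosen representative $z\in pA$ of that class. Then at every step $\rho^{-1}$ is only applied to classes of elements of $pA$, so that the evaluation can always be carried out, and its result is $[a]*[b]$. In particular, the result does not depend on the choice of $\rho^{-1}$ or of the representatives. -/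

import Mathlib

/-! ### Operations attached to a binary operation `∘` on an abelian group -/

namespace CircOp

variable {A : Type*} [AddCommGroup A]

/-- `a * b = a ∘ b - a - b`. -/
def star (circ : A → A → A) (a b : A) : A := circ a b - a - b

/-- `a^{∘ i}` for a natural number `i`: `a^{∘ 0} = 0`, `a^{∘ 1} = a` and
`a^{∘ (i+1)} = a ∘ a^{∘ i}` for `i ≥ 1`. -/
def npow (circ : A → A → A) (a : A) : ℕ → A
  | 0 => 0
  | 1 => a
  | i + 2 => circ a (npow circ a (i + 1))

/-- `a^{∘ i}` for an integer `i`; for `m ≥ 1`, the power `a^{∘ -m}` is the `m`-th power of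
`a^{∘ -1} = cinv a`. -/
def zpow (circ : A → A → A) (cinv : A → A) (a : A) : ℤ → A
  | Int.ofNat i => npow circ a i
  | Int.negSucc i => npow circ (cinv a) (i + 1)

/-- The left series: `leftSeries circ i` is `A^{i+1}`, where `A^1 = A` and `A^{i+1} = A * A^i` is
the additive subgroup generated by all `a * b` with `a ∈ A`, `b ∈ A^i`. -/
def leftSeries (circ : A → A → A) : ℕ → AddSubgroup A
  | 0 => ⊤
  | i + 1 => AddSubgroup.closure {c | ∃ a : A, ∃ b ∈ leftSeries circ i, c = star circ a b}

end CircOp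

/-- A pseudobrace of cardinality `p ^ n` (with `p` prime) on the abelian group `A`. -/
structure Pseudobrace (p n : ℕ) (A : Type*) [AddCommGroup A] where
  /-- the operation `∘` -/
  circ : A → A → A
  /-- the element `a^{∘ -1}` -/
  cinv : A → A
  prime : p.Prime
  card_eq : Nat.card A = p ^ n
  circ_cinv : ∀ a, circ a (cinv a) = 0
  zpow_circ_zpow_circ : ∀ (i j : ℤ) (a b : A),
    circ (circ (CircOp.zpow circ cinv a i) (CircOp.zpow circ cinv a j)) b =
      circ (CircOp.zpow circ cinv a (i + j)) b
  zpow_circ_zpow : ∀ (i j : ℤ) (a : A),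
    circ (CircOp.zpow circ cinv a i) (CircOp.zpow circ cinv a j) =
      CircOp.zpow circ cinv a (i + j)
  npow_circ : ∀ (i : ℕ) (a b : A), circ (CircOp.npow circ a i) b = (circ a)^[i] b
  leftSeries_eq_bot : CircOp.leftSeries circ n = ⊥
  star_add : ∀ a b c : A,
    CircOp.star circ a (b + c) = CircOp.star circ a b + CircOp.star circ a c

/-- The subgroup `p^i A = {p^i a : a ∈ A}`. -/
def pMul (p : ℕ) (A : Type*) [AddCommGroup A] (i : ℕ) : AddSubgroup A :=
  (nsmulAddMonoidHom (α := A) (p ^ i)).range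

/-- The subgroup `ann(p^i) = {a ∈ A : p^i a = 0}`. -/
def pAnn (p : ℕ) (A : Type*) [AddCommGroup A] (i : ℕ) : AddSubgroup A :=
  (nsmulAddMonoidHom (α := A) (p ^ i)).ker

theorem mem_pMul {p : ℕ} {A : Type*} [AddCommGroup A] {i : ℕ} {x : A} :
    x ∈ pMul p A i ↔ ∃ a : A, p ^ i • a = x := Iff.rfl

theorem mem_pAnn {p : ℕ} {A : Type*} [AddCommGroup A] {i : ℕ} {x : A} :
    x ∈ pAnn p A i ↔ p ^ i • x = 0 := Iff.rfl

namespace Pseudobrace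

variable {p n : ℕ} {A : Type*} [AddCommGroup A]

/-- The operation `a * b = a ∘ b - a - b` of a pseudobrace. -/
def star (S : Pseudobrace p n A) (a b : A) : A := CircOp.star S.circ a b

/-- Ideals of a pseudobrace. -/
structure IsIdeal (S : Pseudobrace p n A) (I : AddSubgroup A) : Prop where
  star_mem_right : ∀ a : A, ∀ i ∈ I, S.star a i ∈ I
  star_mem_left : ∀ a : A, ∀ i ∈ I, S.star i a ∈ I
  star_sub_star_mem : ∀ a b : A, ∀ i ∈ I, ∀ j ∈ I, S.star (a + i) (b + j) - S.star a b ∈ I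

/-- Property 1. -/
structure Property1 (S : Pseudobrace p n A) : Prop where
  iterate_mem : ∀ a b : A, (S.star a)^[(p - 1) / 4] b ∈ pMul p A 1
  iterate_ann_mem : ∀ a : A, ∀ i : ℕ, 0 < i → ∀ b ∈ pAnn p A i,
    (S.star a)^[(p - 1) / 4] b ∈ pAnn p A (i - 1)

/-- Property 2 for the natural number `k`. -/
structure Property2 (S : Pseudobrace p n A) (k : ℕ) : Prop where
  smul_eq_iff : ∀ a b : A, p ^ (2 * k) • a = p ^ (2 * k) • b ↔
    p ^ k • CircOp.npow S.circ a (p ^ k) = p ^ k • CircOp.npow S.circ b (p ^ k)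
  isIdeal_pMul : ∀ i : ℕ, S.IsIdeal (pMul p A i)
  isIdeal_pAnn : ∀ i : ℕ, S.IsIdeal (pAnn p A i)
  star_mem_pAnn : ∀ i j : ℕ, i ≤ j → ∀ x ∈ pMul p A i, ∀ y ∈ pAnn p A j,
    S.star x y ∈ pAnn p A (j - i)

/-- The operation `[a] * [b] = [a * b]` of the factor pseudobrace `A / I`, for an ideal `I`. -/
def quotStar (S : Pseudobrace p n A) (I : AddSubgroup A) (hI : S.IsIdeal I) :
    A ⧸ I → A ⧸ I → A ⧸ I :=
  Quotient.map₂ S.star (by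
    intro a a' ha b b' hb
    have ha' : -a + a' ∈ I := QuotientAddGroup.leftRel_apply.mp ha
    have hb' : -b + b' ∈ I := QuotientAddGroup.leftRel_apply.mp hb
    refine QuotientAddGroup.leftRel_apply.mpr ?_
    have h := hI.star_sub_star_mem a b _ ha' _ hb'
    rw [add_neg_cancel_left, add_neg_cancel_left] at h
    rwa [neg_add_eq_sub])

theorem quotStar_mk (S : Pseudobrace p n A) (I : AddSubgroup A) (hI : S.IsIdeal I) (a b : A) :
    S.quotStar I hI (a : A ⧸ I) (b : A ⧸ I) = ((S.star a b : A) : A ⧸ I) := rfl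

/-- Under Property 2, `(p^k x) * y` lies in `p^k A`. -/
theorem exists_pullback (S : Pseudobrace p n A) {k : ℕ} (h2 : S.Property2 k) (x y : A) :
    ∃ z : A, p ^ k • z = S.star (p ^ k • x) y :=
  mem_pMul.mp ((h2.isIdeal_pMul k).star_mem_left y _ (mem_pMul.mpr ⟨x, rfl⟩))

/-- Under Property 2, the class of an element `z` with `p^k z = (p^k x) * y` modulo `ann(p^{2k})`
depends only on the classes of `x` and `y`. -/
theorem pullback_congr (S : Pseudobrace p n A) {k : ℕ} (h2 : S.Property2 k) {x x' y y' z z' : A}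
    (hx : -x + x' ∈ pAnn p A (2 * k)) (hy : -y + y' ∈ pAnn p A (2 * k))
    (hz : p ^ k • z = S.star (p ^ k • x) y) (hz' : p ^ k • z' = S.star (p ^ k • x') y') :
    -z + z' ∈ pAnn p A (2 * k) := by
  have h1 : S.star (p ^ k • x') (-y + y') ∈ pAnn p A k := by
    have h := h2.star_mem_pAnn k (2 * k) (by omega) (p ^ k • x') (mem_pMul.mpr ⟨x', rfl⟩) _ hy
    rwa [show 2 * k - k = k by omega] at h
  have hw : p ^ k • (-x + x') ∈ pAnn p A k := by
    rw [mem_pAnn, smul_smul, ← pow_add, ← two_mul]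
    exact hx
  have h3 := (h2.isIdeal_pAnn k).star_sub_star_mem (p ^ k • x) y _ hw 0 (zero_mem _)
  rw [← smul_add, add_neg_cancel_left, add_zero] at h3
  have h4 : S.star (p ^ k • x') y' = S.star (p ^ k • x') y + S.star (p ^ k • x') (-y + y') := by
    have h := S.star_add (p ^ k • x') y (-y + y')
    rw [add_neg_cancel_left] at h
    exact h
  have h5 : p ^ k • (-z + z') ∈ pAnn p A k := by
    have h := add_mem h3 h1
    have e : p ^ k • (-z + z') =
        S.star (p ^ k • x') y - S.star (p ^ k • x) y + S.star (p ^ k • x') (-y + y') := by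
      rw [smul_add, smul_neg, hz, hz', h4]
      abel
    rwa [e]
  rw [mem_pAnn, smul_smul, ← pow_add, ← two_mul] at h5
  exact h5

/-- The operation `[x] ⊙ [y] = [℘⁻¹((p^k x) * y)]` on `A / ann(p^{2k})`, where `℘⁻¹(c)` is an
element with `p^k ℘⁻¹(c) = c`. -/
noncomputable def odot (S : Pseudobrace p n A) (k : ℕ) (h2 : S.Property2 k) :
    A ⧸ pAnn p A (2 * k) → A ⧸ pAnn p A (2 * k) → A ⧸ pAnn p A (2 * k) :=
  Quotient.map₂ (fun x y => Classical.choose (S.exists_pullback h2 x y)) (by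
    intro x x' hx y y' hy
    exact QuotientAddGroup.leftRel_apply.mpr (S.pullback_congr h2
      (QuotientAddGroup.leftRel_apply.mp hx) (QuotientAddGroup.leftRel_apply.mp hy)
      (Classical.choose_spec (S.exists_pullback h2 x y))
      (Classical.choose_spec (S.exists_pullback h2 x' y'))))

/-- The operation `⊙` does not depend on the choice of `℘⁻¹`. -/
theorem odot_mk (S : Pseudobrace p n A) {k : ℕ} (h2 : S.Property2 k) {x y z : A}
    (hz : p ^ k • z = S.star (p ^ k • x) y) :
    S.odot k h2 (x : A ⧸ pAnn p A (2 * k)) (y : A ⧸ pAnn p A (2 * k)) =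
      (z : A ⧸ pAnn p A (2 * k)) :=
  Quotient.sound (QuotientAddGroup.leftRel_apply.mpr (S.pullback_congr h2
    (by rw [neg_add_cancel]; exact zero_mem _) (by rw [neg_add_cancel]; exact zero_mem _)
    (Classical.choose_spec (S.exists_pullback h2 x y)) hz))

end Pseudobrace

/-- Formal expressions in two variables, built from `+`, `⊙` and `ρ⁻¹`: an expression records which
operations are applied and in which order. -/
inductive Formula : Type
  | fst : Formula
  | snd : Formula
  | add : Formula → Formula → Formula
  | odot : Formula → Formula → Formula
  | rho : Formula → Formula

namespace Formula

variable {p n : ℕ} {A : Type*} [AddCommGroup A]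

/-- The set of results of a formula at `u, v ∈ A / ann(p^{2k})`, for a function `ρ⁻¹ : pA → A`.
The step `ρ⁻¹` takes a class `[z]` with `z ∈ pA` to the class `[ρ⁻¹(z)]`; every representative
`z ∈ pA` of the class is allowed, so that a formula could a priori have several results. -/
def values (S : Pseudobrace p n A) (k : ℕ) (h2 : S.Property2 k) (ρ : pMul p A 1 → A)
    (u v : A ⧸ pAnn p A (2 * k)) : Formula → Set (A ⧸ pAnn p A (2 * k))
  | fst => {u}
  | snd => {v}
  | add s t => {w | ∃ c ∈ values S k h2 ρ u v s, ∃ d ∈ values S k h2 ρ u v t, w = c + d}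
  | odot s t =>
      {w | ∃ c ∈ values S k h2 ρ u v s, ∃ d ∈ values S k h2 ρ u v t, w = S.odot k h2 c d}
  | rho s => {w | ∃ z : pMul p A 1,
      ((z : A) : A ⧸ pAnn p A (2 * k)) ∈ values S k h2 ρ u v s ∧
        w = ((ρ z : A) : A ⧸ pAnn p A (2 * k))}

/-- In the evaluation of the formula at `u, v`, the function `ρ⁻¹` is only ever applied to
(classes of) elements of `pA`. -/
def Admissible (S : Pseudobrace p n A) (k : ℕ) (h2 : S.Property2 k) (ρ : pMul p A 1 → A)
    (u v : A ⧸ pAnn p A (2 * k)) : Formula → Prop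
  | fst => True
  | snd => True
  | add s t => Admissible S k h2 ρ u v s ∧ Admissible S k h2 ρ u v t
  | odot s t => Admissible S k h2 ρ u v s ∧ Admissible S k h2 ρ u v t
  | rho s => Admissible S k h2 ρ u v s ∧
      ∀ c ∈ values S k h2 ρ u v s, ∃ z : pMul p A 1, ((z : A) : A ⧸ pAnn p A (2 * k)) = c

end Formula

/-!
Write `L` for the endomorphism `b ↦ a * b` of `A`, and `m = ⌊(p-1)/4⌋`. The axioms give
`a^{∘ i} = ∑_{j < i} (1 + L)^j (a)` and `a^{∘ i} * b = (1 + L)^i (b) - b`, so both are given by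
binomial coefficients `binom(p^k, j+1)` and powers of `L` when `i = p^k`. Property 1 makes
`T = L^m ∘ p⁻¹ ∘ L^m` a well-defined endomorphism with `p T = L^{2m}`, so that `ℤ[x, y]` acts on `A`
by `x ↦ L`, `y ↦ T` (`divHom`). Since `2m < p`, there are enough powers of `T` to divide by `p^k`:
there is `u ∈ ℤ[x, y]` with `u ≡ 1` modulo `(x, y)`, depending only on `p` and `k` (`logUnit`), with
`a^{∘ p^k} = p^k u(a)` and `a^{∘ p^k} * b = p^k (x u)(b)`. With `c = u(a)`, this says that
`[c] ⊙ [·]` is the action of `x u` (`odot_divHom`).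

The endomorphism `x u` inherits from `L` the two halves of Property 1, and therefore the expression
`(c ⊙ ·)^m ρ⁻¹((c ⊙ ·)^m e)` has a single value, the action of `y u^{2m}` on `e`
(`Formula.EvalsTo.rho_powMap`). So every polynomial in `x u` and `y u^{2m}` is computed by a formula
in `c` and `e` (`Formula.exists_formula_divHom_substHom`). As `u ≡ 1`, these two polynomials
generate `ℤ[x, y]` modulo every power of `(x, y)`, and a power of `(x, y)` acts as `0`. Hence some
polynomial `P` in them is inverse to `u`, and `a = P(c)`, `a * b = (P x u)(b)` are given by formulas
in `c` and `b`.

It remains to obtain `c` from `a`. By Property 2, `f : [a] ↦ [u(a)]` is a permutation of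
`A / ann(p^{2k})`, which has at most `p^n` elements, and `[a] = P(c)` is a formula for `f⁻¹`. Since
`f = (f⁻¹)^{(p^n)! - 1}`, iterating that formula gives one for `f`.
-/

/-! ### Polynomials in two nilpotent variables -/

namespace TwoVar

open MvPolynomial

/-- The ideal `(x, y)` of `ℤ[x, y]`. -/
noncomputable def augIdeal : Ideal (MvPolynomial (Fin 2) ℤ) := Ideal.span {X 0, X 1}

theorem X_zero_mem : X 0 ∈ augIdeal := Ideal.subset_span (by simp)

theorem X_one_mem : X 1 ∈ augIdeal := Ideal.subset_span (by simp)

theorem exists_inv_mod_pow {u : MvPolynomial (Fin 2) ℤ} (hu : u - 1 ∈ augIdeal) (N : ℕ) :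
    ∃ v, u * v - 1 ∈ augIdeal ^ N := by
  refine ⟨∑ i ∈ Finset.range N, (1 - u) ^ i, ?_⟩
  have h := mul_neg_geom_sum (1 - u) N
  rw [sub_sub_cancel] at h
  rw [h, show (1 : MvPolynomial (Fin 2) ℤ) - (1 - u) ^ N - 1 = -((1 - u) ^ N) by ring]
  refine neg_mem (Ideal.pow_mem_pow ?_ N)
  rw [← neg_sub]
  exact neg_mem hu

/-- If `u ≡ 1` modulo `(x, y)`, then `x u` and `y u^M` generate `ℤ[x, y]` modulo any power of
`(x, y)`. -/
theorem exists_aeval_sub_mem {u : MvPolynomial (Fin 2) ℤ} (hu : u - 1 ∈ augIdeal) (M N : ℕ) :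
    ∀ f : MvPolynomial (Fin 2) ℤ, ∃ P : MvPolynomial (Fin 2) ℤ,
      f - aeval ![X 0 * u, X 1 * u ^ M] P ∈ augIdeal ^ N := by
  induction N with
  | zero => intro f; exact ⟨0, by simp⟩
  | succ N ih =>
    obtain ⟨v, hv⟩ := exists_inv_mod_pow hu (N + 1)
    obtain ⟨V, hV⟩ := ih v
    -- `x = (x u) v`, where `v` matters only modulo `(x, y)^N`.
    have hX0 : X 0 - aeval ![X 0 * u, X 1 * u ^ M] (X 0 * V) ∈ augIdeal ^ (N + 1) := by
      have e : X 0 - aeval ![X 0 * u, X 1 * u ^ M] (X 0 * V) =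
          X 0 * u * (v - aeval ![X 0 * u, X 1 * u ^ M] V) - X 0 * (u * v - 1) := by
        simp
        ring
      rw [e, pow_succ']
      refine sub_mem (Ideal.mul_mem_mul (Ideal.mul_mem_right _ _ X_zero_mem) hV) ?_
      rw [← pow_succ']
      exact Ideal.mul_mem_left _ _ hv
    have hX1 : X 1 - aeval ![X 0 * u, X 1 * u ^ M] (X 1 * V ^ M) ∈ augIdeal ^ (N + 1) := by
      have e : X 1 - aeval ![X 0 * u, X 1 * u ^ M] (X 1 * V ^ M) =
          X 1 * u ^ M * (v ^ M - aeval ![X 0 * u, X 1 * u ^ M] V ^ M) -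
            X 1 * ((u * v) ^ M - 1 ^ M) := by
        simp
        ring
      rw [e, pow_succ']
      refine sub_mem (Ideal.mul_mem_mul (Ideal.mul_mem_right _ _ X_one_mem)
        (Ideal.mem_of_dvd _ (sub_dvd_pow_sub_pow _ _ M) hV)) ?_
      rw [← pow_succ']
      exact Ideal.mul_mem_left _ _ (Ideal.mem_of_dvd _ (sub_dvd_pow_sub_pow _ _ M) hv)
    intro f
    induction f using MvPolynomial.induction_on with
    | C a => exact ⟨C a, by simp⟩
    | add f g hf hg =>
      obtain ⟨P, hP⟩ := hf
      obtain ⟨Q, hQ⟩ := hg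
      refine ⟨P + Q, ?_⟩
      rw [map_add, add_sub_add_comm]
      exact add_mem hP hQ
    | mul_X f i hf =>
      obtain ⟨P, hP⟩ := hf
      have key : ∀ Q : MvPolynomial (Fin 2) ℤ,
          X i - aeval ![X 0 * u, X 1 * u ^ M] Q ∈ augIdeal ^ (N + 1) →
          ∃ P : MvPolynomial (Fin 2) ℤ,
            f * X i - aeval ![X 0 * u, X 1 * u ^ M] P ∈ augIdeal ^ (N + 1) := by
        intro Q hQ
        refine ⟨P * Q, ?_⟩
        rw [map_mul, show ∀ a b c d : MvPolynomial (Fin 2) ℤ,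
          a * b - c * d = b * (a - c) + c * (b - d) by intros; ring]
        exact add_mem (Ideal.mul_mem_left _ _ hP) (Ideal.mul_mem_left _ _ hQ)
      fin_cases i
      · exact key _ hX0
      · exact key _ hX1

/-- Modulo a power of `(x, y)`, the inverse of `u` is a polynomial in `x u` and `y u^M`. -/
theorem exists_aeval_mul_sub_one_mem {u : MvPolynomial (Fin 2) ℤ} (hu : u - 1 ∈ augIdeal)
    (M N : ℕ) : ∃ P : MvPolynomial (Fin 2) ℤ,
      aeval (R := ℤ) ![X 0 * u, X 1 * u ^ M] P * u - 1 ∈ augIdeal ^ N := by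
  obtain ⟨v, hv⟩ := exists_inv_mod_pow hu N
  obtain ⟨P, hP⟩ := exists_aeval_sub_mem hu M N v
  refine ⟨P, ?_⟩
  rw [show aeval ![X 0 * u, X 1 * u ^ M] P * u - 1 =
    (u * v - 1) - u * (v - aeval ![X 0 * u, X 1 * u ^ M] P) by ring]
  exact sub_mem hv (Ideal.mul_mem_left _ _ hP)

/-- `∑_{j < p^k} (binom(p^k, j+1) / p^k) x^j`, in which `x^M / p` is written as `y`: with
`v = v_p(j+1)`, the summand is `(binom(p^k, j+1) / p^{k-v}) x^{j-Mv} y^v`. -/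
noncomputable def logUnit (p k M : ℕ) : MvPolynomial (Fin 2) ℤ :=
  ∑ j ∈ Finset.range (p ^ k),
    (((p ^ k).choose (j + 1) / p ^ (k - (j + 1).factorization p) : ℕ) : MvPolynomial (Fin 2) ℤ) *
      (X 0 ^ (j - M * (j + 1).factorization p) * X 1 ^ (j + 1).factorization p)

theorem factorization_succ_le {p k j : ℕ} (hp : p.Prime) (hj : j < p ^ k) :
    (j + 1).factorization p ≤ k := by
  have h := Nat.factorization_choose_prime_pow_add_factorization hp
    (show j + 1 ≤ p ^ k by omega) (Nat.succ_ne_zero j)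
  omega

/-- Hence the exponent `j - M v` in `logUnit` is not truncated. -/
theorem mul_factorization_succ_le {p M : ℕ} (hM : M < p) (j : ℕ) :
    M * (j + 1).factorization p ≤ j := by
  have h1 : p ^ (j + 1).factorization p ≤ j + 1 := Nat.ordProj_le p (Nat.succ_ne_zero j)
  have h2 : ∀ v : ℕ, M * v + 1 ≤ p ^ v := by
    intro v
    induction v with
    | zero => simp
    | succ v ih =>
      calc M * (v + 1) + 1 ≤ (M * v + 1) * (M + 1) := by nlinarith [Nat.zero_le (M * v * M)]
        _ ≤ p ^ v * p := Nat.mul_le_mul ih hM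
        _ = p ^ (v + 1) := (pow_succ _ _).symm
  have := h2 ((j + 1).factorization p)
  omega

theorem pow_sub_factorization_dvd_choose {p k j : ℕ} (hp : p.Prime) (hj : j < p ^ k) :
    p ^ (k - (j + 1).factorization p) ∣ (p ^ k).choose (j + 1) := by
  have h := Nat.factorization_choose_prime_pow_add_factorization hp
    (show j + 1 ≤ p ^ k by omega) (Nat.succ_ne_zero j)
  rw [← show ((p ^ k).choose (j + 1)).factorization p = k - (j + 1).factorization p by omega]
  exact Nat.ordProj_dvd _ _

theorem logUnit_sub_one_mem {p k M : ℕ} (hp : p.Prime) : logUnit p k M - 1 ∈ augIdeal := by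
  obtain ⟨q, hq⟩ : ∃ q, p ^ k = q + 1 :=
    ⟨p ^ k - 1, by have := Nat.pow_pos (n := k) hp.pos; omega⟩
  rw [logUnit, hq, Finset.sum_range_succ', ← hq]
  have h0 : (((p ^ k).choose (0 + 1) / p ^ (k - (0 + 1).factorization p) : ℕ) :
      MvPolynomial (Fin 2) ℤ) *
      (X 0 ^ (0 - M * (0 + 1).factorization p) * X 1 ^ (0 + 1).factorization p) = 1 := by
    simp [Nat.div_self (Nat.pow_pos (n := k) hp.pos)]
  rw [h0, add_sub_cancel_right]
  refine sum_mem fun j _ => Ideal.mul_mem_left _ _ ?_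
  rcases Nat.eq_zero_or_pos ((j + 1 + 1).factorization p) with h | h
  · rw [h]
    exact Ideal.mul_mem_right _ _ (Ideal.pow_mem_of_mem _ X_zero_mem _ (by omega))
  · exact Ideal.mul_mem_left _ _ (Ideal.pow_mem_of_mem _ X_one_mem _ h)

/-- Where `p y = x^M` holds, `p^k` times `logUnit` is `((1 + x)^{p^k} - 1) / x`. -/
theorem pow_mul_map_logUnit {R : Type*} [Ring R] {p k M : ℕ} (hp : p.Prime) (hM : M < p)
    (Φ : MvPolynomial (Fin 2) ℤ →+* R) (hΦ : (p : R) * Φ (X 1) = Φ (X 0) ^ M) :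
    (p : R) ^ k * Φ (logUnit p k M) =
      ∑ j ∈ Finset.range (p ^ k), ((p ^ k).choose (j + 1) : R) * Φ (X 0) ^ j := by
  rw [logUnit, map_sum, Finset.mul_sum]
  refine Finset.sum_congr rfl fun j hj => ?_
  have hj := Finset.mem_range.mp hj
  have hv := factorization_succ_le hp hj
  have hMv := mul_factorization_succ_le hM j
  obtain ⟨c, hc⟩ := pow_sub_factorization_dvd_choose hp hj
  set v := (j + 1).factorization p
  rw [hc, Nat.mul_div_cancel_left _ (Nat.pow_pos hp.pos)]
  have hy : (p : R) ^ v * Φ (X 1) ^ v = Φ (X 0) ^ (M * v) := by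
    rw [pow_mul, ← hΦ, (Nat.cast_commute p (Φ (X 1))).mul_pow]
  have hxy : Commute (Φ (X 0)) (Φ (X 1)) := by
    rw [commute_iff_eq, ← map_mul, ← map_mul, mul_comm]
  calc (p : R) ^ k * Φ (↑c * (X 0 ^ (j - M * v) * X 1 ^ v))
      = (p : R) ^ (k - v) * c * ((p : R) ^ v * (Φ (X 0) ^ (j - M * v) * Φ (X 1) ^ v)) := by
        have hcp : (c : R) * (p : R) ^ v = (p : R) ^ v * c :=
          ((Nat.cast_commute p (c : R)).pow_left v).eq.symm
        rw [← mul_assoc _ ((p : R) ^ v), mul_assoc _ (c : R), hcp, ← mul_assoc _ _ (c : R),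
          ← pow_add, Nat.sub_add_cancel hv]
        simp only [map_mul, map_pow, map_natCast, mul_assoc]
    _ = (p : R) ^ (k - v) * c * (Φ (X 0) ^ (M * v) * Φ (X 0) ^ (j - M * v)) := by
        rw [(hxy.pow_pow _ _).eq, ← mul_assoc ((p : R) ^ v), hy]
    _ = _ := by
        rw [← pow_add, Nat.add_sub_cancel' hMv]
        push_cast
        rfl

end TwoVar

/-! ### Dividing a power of an endomorphism by `p` -/

theorem exists_ringHom_of_commute {R : Type*} [Ring R] {a b : R} (h : Commute a b) :
    ∃ Φ : MvPolynomial (Fin 2) ℤ →+* R, Φ (MvPolynomial.X 0) = a ∧ Φ (MvPolynomial.X 1) = b := by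
  refine ⟨(Polynomial.eval₂RingHom' (Polynomial.eval₂RingHom' (Int.castRingHom R) a
    (fun n => Int.cast_commute n a)) b ?_).comp
      (MvPolynomial.aeval (R := ℤ) ![(Polynomial.C Polynomial.X : Polynomial (Polynomial ℤ)),
        Polynomial.X]).toRingHom, ?_, ?_⟩
  · intro f
    induction f using Polynomial.induction_on' with
    | add f g hf hg => rw [map_add]; exact hf.add_left hg
    | monomial n c =>
      simp only [Polynomial.eval₂RingHom', RingHom.coe_mk, MonoidHom.coe_mk, OneHom.coe_mk,
        Polynomial.eval₂_monomial]
      exact (Int.cast_commute c b).mul_left (h.pow_left n)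
  · simp [Polynomial.eval₂RingHom']
  · simp [Polynomial.eval₂RingHom']

/-- If `L^m` maps `A` into `pA` and `ann(p)` to `0`, then there is an endomorphism
`T = L^m ∘ p⁻¹ ∘ L^m`, which plays the role of `L^{2m} / p`. -/
theorem exists_divided_pow {A : Type*} [AddCommGroup A] (p m : ℕ) (L : Module.End ℤ A)
    (h1 : ∀ b, ∃ z, p • z = (L ^ m) b) (h2 : ∀ z, p • z = 0 → (L ^ m) z = 0) :
    ∃ T : Module.End ℤ A, Commute L T ∧ ∀ b z, p • z = (L ^ m) b → T b = (L ^ m) z := by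
  choose s hs using h1
  have key : ∀ b z, p • z = (L ^ m) b → (L ^ m) (s b) = (L ^ m) z := by
    intro b z hz
    rw [← sub_eq_zero, ← map_sub]
    exact h2 _ (by rw [smul_sub, hs, hz, sub_self])
  refine ⟨(AddMonoidHom.mk' (fun b => (L ^ m) (s b)) ?_).toIntLinearMap, ?_, key⟩
  · intro b c
    rw [← map_add]
    exact key _ _ (by rw [smul_add, hs, hs, map_add])
  · refine LinearMap.ext fun b => ?_
    change L ((L ^ m) (s b)) = (L ^ m) (s (L b))
    rw [key (L b) (L (s b)) (by rw [← map_nsmul, hs, ← Module.End.mul_apply,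
      ← Module.End.mul_apply, ← pow_succ', ← pow_succ]), ← Module.End.mul_apply,
      ← Module.End.mul_apply, ← pow_succ', ← pow_succ]

theorem pow_eq_zero_of_forall_exists_smul {A : Type*} [AddCommGroup A] {p n : ℕ}
    (hA : ∀ x : A, p ^ n • x = 0) {F : Module.End ℤ A} (hF : ∀ b, ∃ z, p • z = F b) :
    F ^ n = 0 := by
  have key : ∀ (i : ℕ) (b : A), ∃ z, p ^ i • z = (F ^ i) b := by
    intro i
    induction i with
    | zero => intro b; exact ⟨b, by simp⟩
    | succ i ih =>
      intro b
      obtain ⟨z, hz⟩ := ih b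
      obtain ⟨w, hw⟩ := hF z
      refine ⟨w, ?_⟩
      rw [pow_succ' F, Module.End.mul_apply, ← hz, map_nsmul, ← hw, smul_smul, pow_succ]
  refine LinearMap.ext fun b => ?_
  obtain ⟨z, hz⟩ := key n b
  rw [← hz, hA, LinearMap.zero_apply]

/-! ### The endomorphisms attached to an element of a pseudobrace -/

namespace Pseudobrace

open MvPolynomial TwoVar

variable {p n : ℕ} {A : Type*} [AddCommGroup A]

/-- Left multiplication `b ↦ a * b`. -/
def leftMul (S : Pseudobrace p n A) (a : A) : Module.End ℤ A :=
  (AddMonoidHom.mk' (S.star a) (S.star_add a)).toIntLinearMap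

theorem leftMul_apply (S : Pseudobrace p n A) (a b : A) : S.leftMul a b = S.star a b := rfl

theorem leftMul_pow_apply (S : Pseudobrace p n A) (a b : A) (i : ℕ) :
    (S.leftMul a ^ i) b = (S.star a)^[i] b := Module.End.pow_apply _ _ _

theorem pow_smul_eq_zero (S : Pseudobrace p n A) (x : A) : p ^ n • x = 0 := by
  rw [← S.card_eq]
  exact card_nsmul_eq_zero'

theorem circ_eq (S : Pseudobrace p n A) (a b : A) :
    S.circ a b = a + (S.leftMul a + 1) b := by
  simp only [LinearMap.add_apply, Module.End.one_apply, leftMul_apply, star, CircOp.star]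
  abel

theorem npow_succ (S : Pseudobrace p n A) (a : A) (i : ℕ) :
    CircOp.npow S.circ a (i + 1) = a + (S.leftMul a + 1) (CircOp.npow S.circ a i) := by
  cases i with
  | zero => simp [CircOp.npow]
  | succ i => exact S.circ_eq a _

theorem npow_eq (S : Pseudobrace p n A) (a : A) (i : ℕ) :
    CircOp.npow S.circ a i = (∑ j ∈ Finset.range i, (S.leftMul a + 1) ^ j) a := by
  induction i with
  | zero => simp [CircOp.npow]
  | succ i ih =>
    rw [npow_succ, ih]
    generalize S.leftMul a + 1 = F
    rw [Finset.sum_range_succ', pow_zero, LinearMap.add_apply, Module.End.one_apply, add_comm,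
      ← Module.End.mul_apply, Finset.mul_sum]
    simp only [pow_succ']

theorem star_npow (S : Pseudobrace p n A) (a b : A) (i : ℕ) :
    S.star (CircOp.npow S.circ a i) b = ((S.leftMul a + 1) ^ i) b - b := by
  have h : (S.circ a)^[i] b = CircOp.npow S.circ a i + ((S.leftMul a + 1) ^ i) b := by
    induction i with
    | zero => simp [CircOp.npow]
    | succ i ih =>
      rw [Function.iterate_succ_apply', ih, circ_eq, npow_succ, pow_succ', Module.End.mul_apply,
        map_add, add_assoc]
  rw [star, CircOp.star, S.npow_circ, h, add_sub_cancel_left]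

theorem exists_smul_eq_leftMul_pow (S : Pseudobrace p n A) (h1 : S.Property1) (a b : A) :
    ∃ z, p • z = (S.leftMul a ^ ((p - 1) / 4)) b := by
  obtain ⟨z, hz⟩ := mem_pMul.mp (h1.iterate_mem a b)
  exact ⟨z, by rw [leftMul_pow_apply, ← hz, pow_one]⟩

theorem exists_divHom (S : Pseudobrace p n A) (h1 : S.Property1) (a : A) :
    ∃ Φ : MvPolynomial (Fin 2) ℤ →+* Module.End ℤ A, Φ (X 0) = S.leftMul a ∧
      ∀ b z, p • z = (S.leftMul a ^ ((p - 1) / 4)) b →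
        Φ (X 1) b = (S.leftMul a ^ ((p - 1) / 4)) z := by
  obtain ⟨T, hT, hTz⟩ := exists_divided_pow p ((p - 1) / 4) (S.leftMul a)
    (S.exists_smul_eq_leftMul_pow h1 a)
    (fun z hz => by
      have h := mem_pAnn.mp (h1.iterate_ann_mem a 1 one_pos z
        (mem_pAnn.mpr (by rwa [pow_one])))
      rwa [Nat.sub_self, pow_zero, one_smul, ← leftMul_pow_apply] at h)
  obtain ⟨Φ, h0, h1⟩ := exists_ringHom_of_commute hT
  exact ⟨Φ, h0, by rwa [h1]⟩

/-- The action of `ℤ[x, y]` on `A` attached to `a` and the exponent `m = ⌊(p-1)/4⌋`: `x` acts as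
`L = (a * ·)` and `y` as `L^{2m} / p`, that is, as `L^m ∘ p⁻¹ ∘ L^m`. -/
noncomputable def divHom (S : Pseudobrace p n A) (h1 : S.Property1) (a : A) :
    MvPolynomial (Fin 2) ℤ →+* Module.End ℤ A := (S.exists_divHom h1 a).choose

theorem divHom_X_zero (S : Pseudobrace p n A) (h1 : S.Property1) (a : A) :
    S.divHom h1 a (X 0) = S.leftMul a := (S.exists_divHom h1 a).choose_spec.1

theorem divHom_X_one (S : Pseudobrace p n A) (h1 : S.Property1) (a : A) {b z : A}
    (h : p • z = (S.leftMul a ^ ((p - 1) / 4)) b) :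
    S.divHom h1 a (X 1) b = (S.leftMul a ^ ((p - 1) / 4)) z :=
  (S.exists_divHom h1 a).choose_spec.2 b z h

theorem cast_mul_divHom_X_one (S : Pseudobrace p n A) (h1 : S.Property1) (a : A) :
    (p : Module.End ℤ A) * S.divHom h1 a (X 1) = S.divHom h1 a (X 0) ^ (2 * ((p - 1) / 4)) := by
  refine LinearMap.ext fun b => ?_
  obtain ⟨z, hz⟩ := S.exists_smul_eq_leftMul_pow h1 a b
  rw [Module.End.mul_apply, S.divHom_X_one h1 a hz, Module.End.natCast_apply, ← map_nsmul, hz,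
    divHom_X_zero, ← Module.End.mul_apply, ← pow_add, two_mul]

/-- Both `L` and `L^m ∘ p⁻¹ ∘ L^m` are nilpotent: the image of `L^m` lies in `pA`, and
`p^n A = 0`. -/
theorem divHom_eq_zero (S : Pseudobrace p n A) (h1 : S.Property1) (a : A)
    {f : MvPolynomial (Fin 2) ℤ} (hf : f ∈ augIdeal ^ ((p - 1) / 4 * n + n)) :
    S.divHom h1 a f = 0 := by
  have hL := S.exists_smul_eq_leftMul_pow h1 a
  have hx : X 0 ^ ((p - 1) / 4 * n) ∈ RingHom.ker (S.divHom h1 a) := by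
    rw [RingHom.mem_ker, map_pow, divHom_X_zero, pow_mul]
    exact pow_eq_zero_of_forall_exists_smul S.pow_smul_eq_zero hL
  have hy : X 1 ^ n ∈ RingHom.ker (S.divHom h1 a) := by
    rw [RingHom.mem_ker, map_pow]
    refine pow_eq_zero_of_forall_exists_smul S.pow_smul_eq_zero fun b => ?_
    obtain ⟨z, hz⟩ := hL b
    rw [S.divHom_X_one h1 a hz]
    exact hL z
  rw [augIdeal, Ideal.span_insert] at hf
  have h := Ideal.sup_pow_add_le_pow_sup_pow hf
  rw [Ideal.span_singleton_pow, Ideal.span_singleton_pow] at h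
  refine (sup_le ?_ ?_ : _ ≤ RingHom.ker (S.divHom h1 a)) h
  · rwa [Ideal.span_singleton_le_iff_mem]
  · rwa [Ideal.span_singleton_le_iff_mem]

/-- The polynomial `u` with `a^{∘ p^k} = p^k u(a)` and `(a^{∘ p^k}) * b = p^k (x u)(b)`. -/
noncomputable abbrev unitPoly (p k : ℕ) : MvPolynomial (Fin 2) ℤ :=
  logUnit p k (2 * ((p - 1) / 4))

/-- The substitution `x ↦ x u`, `y ↦ y u^{2m}` in `ℤ[x, y]`, `m = ⌊(p-1)/4⌋`; it respects the
relation `p y = x^{2m}`. -/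
noncomputable def substHom (p k : ℕ) : MvPolynomial (Fin 2) ℤ →ₐ[ℤ] MvPolynomial (Fin 2) ℤ :=
  aeval ![X 0 * unitPoly p k, X 1 * unitPoly p k ^ (2 * ((p - 1) / 4))]

theorem substHom_X_zero (p k : ℕ) : substHom p k (X 0) = X 0 * unitPoly p k := by
  simp [substHom]

theorem substHom_X_one (p k : ℕ) :
    substHom p k (X 1) = X 1 * unitPoly p k ^ (2 * ((p - 1) / 4)) := by
  simp [substHom]

/-- The right-hand side maps `a` to `a^{∘ p^k}` by `npow_eq`. -/
theorem pow_mul_divHom_unitPoly (S : Pseudobrace p n A) (h1 : S.Property1) (k : ℕ) (a : A) :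
    (p : Module.End ℤ A) ^ k * S.divHom h1 a (unitPoly p k) =
      ∑ j ∈ Finset.range (p ^ k), (S.leftMul a + 1) ^ j := by
  rw [unitPoly, pow_mul_map_logUnit S.prime (by have := S.prime.pos; omega) _
    (S.cast_mul_divHom_X_one h1 a), divHom_X_zero]
  have h := congrArg (Polynomial.aeval (R := ℤ) (S.leftMul a))
    (Polynomial.geom_sum_X_comp_X_add_one_eq_sum (R := ℤ) (p ^ k))
  simpa [Polynomial.aeval_comp] using h.symm

theorem pow_smul_divHom_unitPoly (S : Pseudobrace p n A) (h1 : S.Property1) (k : ℕ) (a : A) :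
    p ^ k • S.divHom h1 a (unitPoly p k) a = CircOp.npow S.circ a (p ^ k) := by
  rw [npow_eq, ← pow_mul_divHom_unitPoly S h1, ← Nat.cast_pow, Module.End.mul_apply,
    Module.End.natCast_apply]

theorem pow_smul_divHom_mul_unitPoly (S : Pseudobrace p n A) (h1 : S.Property1) (k : ℕ)
    (a b : A) :
    p ^ k • S.divHom h1 a (X 0 * unitPoly p k) b = S.star (CircOp.npow S.circ a (p ^ k)) b := by
  have h := congrArg (fun F : Module.End ℤ A => F b) (geom_sum_mul (S.leftMul a + 1) (p ^ k))
  rw [add_sub_cancel_right, ← pow_mul_divHom_unitPoly S h1, mul_assoc, ← S.divHom_X_zero h1,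
    ← map_mul, mul_comm (unitPoly p k), ← Nat.cast_pow, Module.End.mul_apply] at h
  rw [← Module.End.natCast_apply (R := ℤ), h, star_npow, divHom_X_zero]
  rfl

/-! ### `⊙` in terms of the action of `ℤ[x, y]` -/

theorem divHom_pow_unitPoly (S : Pseudobrace p n A) (h1 : S.Property1) (k m : ℕ) (a b : A) :
    (S.divHom h1 a (X 0 * unitPoly p k) ^ m) b =
      S.divHom h1 a (unitPoly p k ^ m) ((S.leftMul a ^ m) b) := by
  rw [← divHom_X_zero S h1, ← map_pow, ← map_pow, ← Module.End.mul_apply, ← map_mul, mul_pow,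
    mul_comm]

theorem divHom_pow_unitPoly' (S : Pseudobrace p n A) (h1 : S.Property1) (k m : ℕ) (a b : A) :
    (S.divHom h1 a (X 0 * unitPoly p k) ^ m) b =
      (S.leftMul a ^ m) (S.divHom h1 a (unitPoly p k ^ m) b) := by
  rw [← divHom_X_zero S h1, ← map_pow, ← map_pow, ← Module.End.mul_apply, ← map_mul, mul_pow]

theorem exists_smul_eq_divHom_pow (S : Pseudobrace p n A) (h1 : S.Property1) (k : ℕ) (a b : A) :
    ∃ z, p • z = (S.divHom h1 a (X 0 * unitPoly p k) ^ ((p - 1) / 4)) b := by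
  rw [divHom_pow_unitPoly']
  exact S.exists_smul_eq_leftMul_pow h1 a _

/-- Let `D` be the action of `x u`. The action of `y u^{2m}` is `D^m ∘ p⁻¹ ∘ D^m`. -/
theorem divHom_pow_eq_of_smul_eq (S : Pseudobrace p n A) (h1 : S.Property1) (k : ℕ) {a b z : A}
    (h : p • z = (S.divHom h1 a (X 0 * unitPoly p k) ^ ((p - 1) / 4)) b) :
    S.divHom h1 a (X 1 * unitPoly p k ^ (2 * ((p - 1) / 4))) b =
      (S.divHom h1 a (X 0 * unitPoly p k) ^ ((p - 1) / 4)) z := by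
  rw [divHom_pow_unitPoly'] at h
  rw [divHom_pow_unitPoly, ← S.divHom_X_one h1 a h, ← Module.End.mul_apply,
    ← Module.End.mul_apply, ← map_mul, ← map_mul]
  congr 2
  ring

theorem divHom_pow_mem_pAnn (S : Pseudobrace p n A) (h1 : S.Property1) (k : ℕ) (a : A) {i : ℕ}
    {z : A} (hz : z ∈ pAnn p A (i + 1)) :
    (S.divHom h1 a (X 0 * unitPoly p k) ^ ((p - 1) / 4)) z ∈ pAnn p A i := by
  have h := mem_pAnn.mp (h1.iterate_ann_mem a (i + 1) i.succ_pos z hz)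
  rw [Nat.add_sub_cancel, ← leftMul_pow_apply] at h
  rw [mem_pAnn, divHom_pow_unitPoly, ← map_nsmul, h, map_zero]

/-- For `c = u(a)`, the operation `[c] ⊙ [·]` is the action of `x u` for `a`. -/
theorem odot_divHom (S : Pseudobrace p n A) (h1 : S.Property1) {k : ℕ} (h2 : S.Property2 k)
    (a b : A) :
    S.odot k h2 (S.divHom h1 a (unitPoly p k) a : A ⧸ pAnn p A (2 * k)) b =
      ((S.divHom h1 a (X 0 * unitPoly p k) b : A) : A ⧸ pAnn p A (2 * k)) := by
  refine S.odot_mk h2 ?_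
  rw [pow_smul_divHom_mul_unitPoly, pow_smul_divHom_unitPoly]

theorem mk_eq_mk_iff {i : ℕ} {a b : A} :
    (a : A ⧸ pAnn p A i) = b ↔ p ^ i • a = p ^ i • b := by
  rw [QuotientAddGroup.eq, mem_pAnn, smul_add, smul_neg, neg_add_eq_zero]

/-- The map `[a] ↦ [u(a)]` of `A / ann(p^{2k})`, where `a^{∘ p^k} = p^k u(a)`. The equivalence in
Property 2 says exactly that this map is well defined and injective. -/
noncomputable def powMap (S : Pseudobrace p n A) (h1 : S.Property1) {k : ℕ}
    (h2 : S.Property2 k) : A ⧸ pAnn p A (2 * k) → A ⧸ pAnn p A (2 * k) :=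
  Quotient.map (fun a => S.divHom h1 a (unitPoly p k) a) (by
    intro a b hab
    have hab := mk_eq_mk_iff.mp (Quotient.sound hab)
    refine Quotient.exact (mk_eq_mk_iff.mpr ?_)
    rw [two_mul, pow_add, mul_smul, mul_smul, pow_smul_divHom_unitPoly,
      pow_smul_divHom_unitPoly]
    exact (h2.smul_eq_iff a b).mp hab)

theorem powMap_mk (S : Pseudobrace p n A) (h1 : S.Property1) {k : ℕ} (h2 : S.Property2 k)
    (a : A) : S.powMap h1 h2 a = (S.divHom h1 a (unitPoly p k) a : A ⧸ pAnn p A (2 * k)) := rfl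

theorem finite (S : Pseudobrace p n A) : Finite A :=
  Nat.finite_of_card_ne_zero (by rw [S.card_eq]; exact (Nat.pow_pos S.prime.pos).ne')

theorem powMap_bijective (S : Pseudobrace p n A) (h1 : S.Property1) {k : ℕ}
    (h2 : S.Property2 k) : Function.Bijective (S.powMap h1 h2) := by
  have := S.finite
  refine Finite.injective_iff_bijective.mp ?_
  rintro ⟨a⟩ ⟨b⟩ hab
  have hab := mk_eq_mk_iff.mp hab
  rw [two_mul, pow_add, mul_smul, mul_smul, pow_smul_divHom_unitPoly,
    pow_smul_divHom_unitPoly] at hab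
  exact mk_eq_mk_iff.mpr ((h2.smul_eq_iff a b).mpr hab)

/-- A permutation of a quotient of `A` has order dividing `(p^n)!`, so that its inverse has itself
as a power whose exponent does not depend on `A`. -/
theorem symm_iterate_factorial_sub_one (S : Pseudobrace p n A) (I : AddSubgroup A)
    (f : A ⧸ I ≃ A ⧸ I) (q : A ⧸ I) : f.symm^[(p ^ n).factorial - 1] q = f q := by
  have := S.finite
  have hle : Nat.card (A ⧸ I) ≤ p ^ n := by
    rw [← S.card_eq]
    exact Nat.card_le_card_of_surjective _ (QuotientAddGroup.mk'_surjective I)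
  have h1 : (f : Equiv.Perm (A ⧸ I))⁻¹ ^ (p ^ n).factorial = 1 := by
    obtain ⟨c, hc⟩ := Nat.factorial_dvd_factorial hle
    rw [hc, pow_mul, ← Nat.card_perm, pow_card_eq_one', one_pow]
  have h2 : (f : Equiv.Perm (A ⧸ I))⁻¹ ^ ((p ^ n).factorial - 1) = f := by
    refine (mul_eq_one_iff_eq_inv.mp ?_).trans (inv_inv _)
    rw [← pow_succ, Nat.sub_add_cancel (Nat.factorial_pos _), h1]
  conv_rhs => rw [← h2]
  rw [← Equiv.Perm.iterate_eq_pow]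
  rfl

end Pseudobrace

/-! ### Evaluation of formulas -/

namespace Formula

open MvPolynomial TwoVar

section Evaluation

variable {p n k : ℕ} {A : Type*} [AddCommGroup A] {S : Pseudobrace p n A} {h2 : S.Property2 k}
  {ρ : pMul p A 1 → A} {x y : A ⧸ pAnn p A (2 * k)}

/-- The evaluation of `t` at `x, y` can be carried out, and `w` is its only result. -/
structure EvalsTo (S : Pseudobrace p n A) (k : ℕ) (h2 : S.Property2 k) (ρ : pMul p A 1 → A)
    (x y : A ⧸ pAnn p A (2 * k)) (t : Formula) (w : A ⧸ pAnn p A (2 * k)) : Prop where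
  admissible : t.Admissible S k h2 ρ x y
  values_eq : t.values S k h2 ρ x y = {w}

theorem EvalsTo.add {s t : Formula} {c d : A ⧸ pAnn p A (2 * k)}
    (hs : s.EvalsTo S k h2 ρ x y c) (ht : t.EvalsTo S k h2 ρ x y d) :
    (s.add t).EvalsTo S k h2 ρ x y (c + d) := by
  refine ⟨⟨hs.admissible, ht.admissible⟩, ?_⟩
  simp [values, hs.values_eq, ht.values_eq]

/-- The sum of `r + 1` copies of a formula. -/
def succSmul (t : Formula) : ℕ → Formula
  | 0 => t
  | r + 1 => (t.succSmul r).add t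

theorem EvalsTo.succSmul {t : Formula} {c : A ⧸ pAnn p A (2 * k)}
    (ht : t.EvalsTo S k h2 ρ x y c) (r : ℕ) :
    (t.succSmul r).EvalsTo S k h2 ρ x y ((r + 1) • c) := by
  induction r with
  | zero => simpa [Formula.succSmul] using ht
  | succ r ih =>
    rw [succ_nsmul]
    exact ih.add ht

theorem values_odot_iterate {s : Formula} {c : A ⧸ pAnn p A (2 * k)}
    (hs : s.EvalsTo S k h2 ρ x y c) (t : Formula) (i : ℕ) :
    ((odot s)^[i] t).values S k h2 ρ x y =
      (S.odot k h2 c)^[i] '' t.values S k h2 ρ x y := by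
  induction i with
  | zero => simp
  | succ i ih =>
    rw [Function.iterate_succ_apply', Function.iterate_succ', Set.image_comp, ← ih]
    ext w
    simp [values, hs.values_eq, eq_comm]

theorem admissible_odot_iterate {s t : Formula} (hs : s.Admissible S k h2 ρ x y)
    (ht : t.Admissible S k h2 ρ x y) (i : ℕ) :
    ((odot s)^[i] t).Admissible S k h2 ρ x y := by
  induction i with
  | zero => exact ht
  | succ i ih =>
    rw [Function.iterate_succ_apply']
    exact ⟨hs, ih⟩

theorem odot_powMap_iterate (h1 : S.Property1) (a b : A) (i : ℕ) :
    (S.odot k h2 (S.powMap h1 h2 a))^[i] (b : A ⧸ pAnn p A (2 * k)) =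
      (((S.divHom h1 a (X 0 * Pseudobrace.unitPoly p k) ^ i) b : A) : A ⧸ pAnn p A (2 * k)) := by
  induction i with
  | zero => simp
  | succ i ih =>
    rw [Function.iterate_succ_apply', ih, S.powMap_mk h1 h2, S.odot_divHom h1 h2, pow_succ',
      Module.End.mul_apply]

theorem EvalsTo.odot_powMap (h1 : S.Property1) {s t : Formula} {a e : A}
    (hs : s.EvalsTo S k h2 ρ x y (S.powMap h1 h2 a)) (ht : t.EvalsTo S k h2 ρ x y e) :
    (odot s t).EvalsTo S k h2 ρ x y
      (S.divHom h1 a (X 0 * Pseudobrace.unitPoly p k) e : A ⧸ pAnn p A (2 * k)) := by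
  refine ⟨⟨hs.admissible, ht.admissible⟩, ?_⟩
  have h := values_odot_iterate hs t 1
  rw [ht.values_eq, Set.image_singleton, odot_powMap_iterate h1, pow_one] at h
  exact h

/-- The division by `p` in `(c ⊙ ·)^m ρ⁻¹((c ⊙ ·)^m e)`, `m = ⌊(p-1)/4⌋`, is possible since the
inner `(c ⊙ ·)^m` maps into `pA`. It is ambiguous up to `ann(p^{2k+1})`, and the outer
`(c ⊙ ·)^m` maps this into `ann(p^{2k})`. -/
theorem EvalsTo.rho_powMap (h1 : S.Property1) (hρ : ∀ z : pMul p A 1, p • ρ z = (z : A))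
    {s t : Formula} {a e : A} (hs : s.EvalsTo S k h2 ρ x y (S.powMap h1 h2 a))
    (ht : t.EvalsTo S k h2 ρ x y e) :
    ((odot s)^[(p - 1) / 4] (rho ((odot s)^[(p - 1) / 4] t))).EvalsTo S k h2 ρ x y
      (S.divHom h1 a (X 1 * Pseudobrace.unitPoly p k ^ (2 * ((p - 1) / 4))) e :
        A ⧸ pAnn p A (2 * k)) := by
  obtain ⟨z, hz⟩ := S.exists_smul_eq_divHom_pow h1 k a e
  have hval : ((odot s)^[(p - 1) / 4] t).values S k h2 ρ x y =
      {((p • z : A) : A ⧸ pAnn p A (2 * k))} := by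
    rw [values_odot_iterate hs, ht.values_eq, Set.image_singleton, odot_powMap_iterate h1, hz]
  have hmem : p • z ∈ pMul p A 1 := mem_pMul.mpr ⟨z, by rw [pow_one]⟩
  have hadm : (rho ((odot s)^[(p - 1) / 4] t)).Admissible S k h2 ρ x y := by
    refine ⟨admissible_odot_iterate hs.admissible ht.admissible _, ?_⟩
    rw [hval]
    rintro c rfl
    exact ⟨⟨p • z, hmem⟩, rfl⟩
  refine ⟨admissible_odot_iterate hs.admissible hadm _, ?_⟩
  rw [values_odot_iterate hs]
  refine Set.eq_singleton_iff_nonempty_unique_mem.mpr ⟨Set.Nonempty.image _ ?_, ?_⟩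
  · exact ⟨_, ⟨p • z, hmem⟩, by rw [hval, Set.mem_singleton_iff], rfl⟩
  · rintro _ ⟨_, ⟨z', hz', rfl⟩, rfl⟩
    rw [hval, Set.mem_singleton_iff, Pseudobrace.mk_eq_mk_iff, ← hρ z'] at hz'
    rw [odot_powMap_iterate h1, S.divHom_pow_eq_of_smul_eq h1 k hz,
      Pseudobrace.mk_eq_mk_iff, ← sub_eq_zero, ← smul_sub, ← map_sub]
    refine S.divHom_pow_mem_pAnn h1 k a (mem_pAnn.mpr ?_)
    rw [pow_succ, mul_smul, smul_sub, smul_sub, hz', sub_self]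

end Evaluation

universe w

/-- Let `c = [u(a)]`. For every `P ∈ ℤ[x, y]` there is a formula in `c` and `e` that computes
`P(x u, y u^{2m})(e)`, the same one for all `A` and `a`. -/
theorem exists_formula_divHom_substHom {p n : ℕ} (k : ℕ) (hp : p.Prime)
    (P : MvPolynomial (Fin 2) ℤ) :
    ∃ F : Formula → Formula → Formula, ∀ (A : Type w) [AddCommGroup A] (S : Pseudobrace p n A)
      (h1 : S.Property1) (h2 : S.Property2 k) (ρ : pMul p A 1 → A),
      (∀ z : pMul p A 1, p • ρ z = (z : A)) → ∀ (x y : A ⧸ pAnn p A (2 * k)) (a : A) (s : Formula),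
      s.EvalsTo S k h2 ρ x y (S.powMap h1 h2 a) → ∀ (e : A) (t : Formula),
      t.EvalsTo S k h2 ρ x y e →
      (F s t).EvalsTo S k h2 ρ x y
        (S.divHom h1 a (Pseudobrace.substHom p k P) e : A ⧸ pAnn p A (2 * k)) := by
  induction P using MvPolynomial.induction_on with
  | C d =>
    have hpn : 0 < p ^ n := Nat.pow_pos hp.pos
    -- `d` is replaced by a positive number congruent to it modulo `p^n`.
    refine ⟨fun _ t => t.succSmul ((d % (p ^ n : ℕ)).toNat + (p ^ n - 1)), ?_⟩
    intro A _ S h1 h2 ρ _ x y a s _ e t ht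
    convert ht.succSmul _ using 1
    have hd := Int.emod_nonneg d (Int.natCast_ne_zero.mpr hpn.ne')
    have hnat : (((d % (p ^ n : ℕ)).toNat + (p ^ n - 1) + 1 : ℕ) : ℤ) =
        d + (p ^ n : ℕ) * (1 - d / (p ^ n : ℕ)) := by
      have := Int.emod_add_mul_ediv d (p ^ n : ℕ)
      rw [add_assoc, Nat.sub_add_cancel hpn, Nat.cast_add, Int.toNat_of_nonneg hd]
      linarith
    rw [← QuotientAddGroup.mk_nsmul, ← natCast_zsmul e, hnat, add_smul, mul_smul,
      natCast_zsmul, S.pow_smul_eq_zero, add_zero]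
    simp
  | add P Q hP hQ =>
    obtain ⟨F, hF⟩ := hP
    obtain ⟨G, hG⟩ := hQ
    refine ⟨fun s t => (F s t).add (G s t), ?_⟩
    intro A _ S h1 h2 ρ hρ x y a s hs e t ht
    rw [map_add, map_add, LinearMap.add_apply, QuotientAddGroup.mk_add]
    exact (hF A S h1 h2 ρ hρ x y a s hs e t ht).add (hG A S h1 h2 ρ hρ x y a s hs e t ht)
  | mul_X P i hP =>
    obtain ⟨F, hF⟩ := hP
    fin_cases i
    · refine ⟨fun s t => F s (odot s t), ?_⟩
      intro A _ S h1 h2 ρ hρ x y a s hs e t ht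
      have h := hF A S h1 h2 ρ hρ x y a s hs _ _ (hs.odot_powMap h1 ht)
      rw [← Module.End.mul_apply, ← map_mul, ← Pseudobrace.substHom_X_zero, ← map_mul] at h
      exact h
    · refine ⟨fun s t => F s ((odot s)^[(p - 1) / 4] (rho ((odot s)^[(p - 1) / 4] t))), ?_⟩
      intro A _ S h1 h2 ρ hρ x y a s hs e t ht
      have h := hF A S h1 h2 ρ hρ x y a s hs _ _ (hs.rho_powMap h1 hρ ht)
      rw [← Module.End.mul_apply, ← map_mul, ← Pseudobrace.substHom_X_one, ← map_mul] at h
      exact h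

end Formula

theorem mainTheorem2 (p n k : ℕ) (hp : 3 < p) :
    ∃ t : Formula, ∀ (A : Type*) [AddCommGroup A] (S : Pseudobrace p n A),
      S.Property1 → ∀ h2 : S.Property2 k,
        ∀ ρ : pMul p A 1 → A, (∀ x : pMul p A 1, p • ρ x = (x : A)) →
          ∀ a b : A,
            t.Admissible S k h2 ρ (a : A ⧸ pAnn p A (2 * k)) (b : A ⧸ pAnn p A (2 * k)) ∧
            t.values S k h2 ρ (a : A ⧸ pAnn p A (2 * k)) (b : A ⧸ pAnn p A (2 * k)) =
              {S.quotStar (pAnn p A (2 * k)) (h2.isIdeal_pAnn (2 * k))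
                (a : A ⧸ pAnn p A (2 * k)) (b : A ⧸ pAnn p A (2 * k))} := by
  by_cases hprime : p.Prime
  swap
  -- For composite `p` there are no pseudobraces.
  · exact ⟨Formula.fst, fun A _ S => absurd S.prime hprime⟩
  obtain ⟨P, hP⟩ := TwoVar.exists_aeval_mul_sub_one_mem
    (TwoVar.logUnit_sub_one_mem (k := k) (M := 2 * ((p - 1) / 4)) hprime)
    (2 * ((p - 1) / 4)) ((p - 1) / 4 * n + n)
  obtain ⟨F, hF⟩ := Formula.exists_formula_divHom_substHom (n := n) k hprime P
  obtain ⟨G, hG⟩ := Formula.exists_formula_divHom_substHom (n := n) k hprime (P * MvPolynomial.X 0)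
  refine ⟨G ((fun s => F s s)^[(p ^ n).factorial - 1] Formula.fst) Formula.snd, ?_⟩
  intro A _ S h1 h2 ρ hρ a b
  -- `P(x u, y u^{2m}) u` acts as the identity.
  have hinv : ∀ a e : A, S.divHom h1 a (Pseudobrace.substHom p k P)
      (S.divHom h1 a (Pseudobrace.unitPoly p k) e) = e := by
    intro a e
    have h := S.divHom_eq_zero h1 a hP
    change S.divHom h1 a (Pseudobrace.substHom p k P * Pseudobrace.unitPoly p k - 1) = 0 at h
    rw [map_sub, map_one, sub_eq_zero, map_mul] at h
    rw [← Module.End.mul_apply, h, Module.End.one_apply]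
  let f := Equiv.ofBijective _ (S.powMap_bijective h1 h2)
  -- From `c = [u(a')]`, the formula `F c c` computes `P(x u, y u^{2m}) u(a') = a'`.
  have hstep : ∀ (s : Formula) (q : A ⧸ pAnn p A (2 * k)), s.EvalsTo S k h2 ρ a b q →
      (F s s).EvalsTo S k h2 ρ a b (f.symm q) := by
    intro s q hs
    obtain ⟨c, hc⟩ := QuotientAddGroup.mk_surjective (f.symm q)
    have hq : q = S.powMap h1 h2 c := by
      rw [hc]
      exact (f.apply_symm_apply q).symm
    have h := hF A S h1 h2 ρ hρ a b c s (hq ▸ hs) _ s (hq ▸ hs)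
    rwa [hinv, hc] at h
  have hiter : ∀ i : ℕ, ((fun s => F s s)^[i] Formula.fst).EvalsTo S k h2 ρ a b
      (f.symm^[i] a) := by
    intro i
    induction i with
    | zero => exact ⟨trivial, rfl⟩
    | succ i ih =>
      rw [Function.iterate_succ_apply', Function.iterate_succ_apply']
      exact hstep _ _ ih
  have hpow := hiter ((p ^ n).factorial - 1)
  -- A large power of `f⁻¹` is `f`, so the inner formula evaluates to `f [a] = [u(a)]`.
  rw [S.symm_iterate_factorial_sub_one _ f a] at hpow
  have h := hG A S h1 h2 ρ hρ a b a _ hpow b Formula.snd ⟨trivial, rfl⟩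
  -- `P(x u, y u^{2m}) (x u)` acts as `x`, that is, as `b ↦ a * b`.
  have e : S.divHom h1 a (Pseudobrace.substHom p k
      (P * MvPolynomial.X 0)) b = S.star a b := by
    rw [map_mul, Pseudobrace.substHom_X_zero,
      mul_comm (MvPolynomial.X 0 : MvPolynomial (Fin 2) ℤ), map_mul, map_mul,
      Module.End.mul_apply, Module.End.mul_apply, hinv, S.divHom_X_zero, S.leftMul_apply]
  rw [e] at h
  exact ⟨h.admissible, h.values_eq⟩
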